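/- Let $(\mathcal S,\Sigma)$ be a measurable space, $\phi$ a measure on it, and $P_F$ a Markov kernel on $(\mathcal S,\Sigma)$. Assume that $P_F$ is Harris recurrent with respect to $\phi$, that is: - $P_F$ is $\phi$-irreducible: every $B\in\Sigma$ with $\phi(B)>0$ is reached with positive probability from every $s\in\mathcal S$; - for every $B\in\Sigma$ with $\phi(B)>0$, the Markov chain $(X_k)_{k\ge0}$ with kernel $P_F$ started at any $s\in B$ satisfies $\mathbb P_s(\sigma_B<\infty)=1$, where $\sigma_B=\inf\{k\ge1: X_k\in B\}$. Let $\mathcal X\in\Sigma$ with $\phi(\mathcal X)>0$ satisfy the minorization condition: there are a measurable $\varepsilon:\mathcal S\to[0,\infty)$ with $\{\varepsilon>0\}=\mathcal X$ and a probability measure $\nu$ on $\mathcal S$ such that $P_F(s,B)\ge\varepsilon(s)\,\nu(B)$ for all $s\in\mathcal S$, $B\in\Sigma$ (hence $\varepsilon\le1$). Fix such $\varepsilon$ and $\nu$. Put $R_\nu(x,\cdot)=\dfrac{P_F(x,\cdot)-\varepsilon(x)\nu}{1-\varepsilon(x)}$ if $\varepsilon(x)<1$ and $R_\nu(x,\cdot)=\nu$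 if $\varepsilon(x)=1$. Let $Z_k=(X_k,Y_k)$ be the split chain on $\mathcal S\times\{0,1\}$: given $Z_k=(x,y)$, the state $X_{k+1}$ is drawn from $R_\nu(x,\cdot)$ if $y=0$ and from $\nu$ if $y=1$, and then $Y_{k+1}=1$ with probability $\varepsilon(X_{k+1})$ and $Y_{k+1}=0$ otherwise. Let $\mathcal S_0=\mathcal X\times\{1\}$ and $\sigma=\inf\{k\ge1: Z_k\in\mathcal S_0\}$. For $z\in\mathcal S_0$ and measurable $B\subseteq\mathcal X$ define $$P_F^\top(B)=\mathbb E_z\big[\mathbf 1_{\{\sigma<\infty\}}\mathbf 1_B(X_\sigma)\big].$$ Then: 1. $P_F^\top(B)$ does not depend on $z\in\mathcal S_0$, and $P_F^\top$ is a probability measure on $\mathcal X$ (with the trace $\sigma$-algebra). 2. There is exactly one measure $\lambda$ on $\mathcal S$ that is invariant ($\lambda P_F=\lambda$) and satisfies $\int_{\mathcal S}\varepsilon\,d\lambda=1$; for every $z\in\mathcal S_0$ and every measurable $f:\mathcal S\to[0,\infty]$ it satisfies $\int f\,d\lambda=\mathbb E_z\big[\sum_{1\le k\le\sigma}f(X_k)\big]$.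 3. For every measurable $B\subseteq\mathcal X$, $P_F^\top(B)=\int_B\varepsilon\,d\lambda$. -/

import Mathlib

open MeasureTheory ProbabilityTheory
open scoped ENNReal NNReal

noncomputable section

namespace GFN

section Chain

variable {S : Type*} [MeasurableSpace S]

/-- The law `ℙ_s` on trajectories `ℕ → S` of the canonical time-homogeneous Markov chain with
Markov kernel `P`, started at `X₀ = s` (Ionescu-Tulcea). -/
def chainLaw (P : Kernel S S) [IsMarkovKernel P] (s : S) : Measure (ℕ → S) :=
  Kernel.traj (X := fun _ : ℕ => S)
    (fun n => P.comap (fun h : (i : Finset.Iic n) → S => h ⟨n, Finset.mem_Iic.2 le_rfl⟩)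
      (measurable_pi_apply _))
    0 (fun _ => s)

/-- The return time `σ_B = inf {k ≥ 1 | X_k ∈ B}`, with value `⊤` if the set is empty. -/
def returnTime (B : Set S) : (ℕ → S) → WithTop ℕ :=
  hittingAfter (fun (k : ℕ) (ω : ℕ → S) => ω k) B 1

/-- `P` is `φ`-irreducible, and for each measurable `B` with `φ B > 0` the chain started
anywhere in `B` returns to `B` in finite time with probability one. -/
structure HarrisRecurrent (φ : Measure S) (P : Kernel S S) [IsMarkovKernel P] : Prop where
  irreducible : Kernel.IsIrreducible φ P
  returns : ∀ B : Set S, MeasurableSet B → 0 < φ B →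
    ∀ s ∈ B, chainLaw P s {ω | returnTime B ω < ⊤} = 1

/-- The data `(ε, ν)` witnessing that `X` satisfies the minorization condition. -/
structure Minorization (φ : Measure S) (P : Kernel S S) (X : Set S) where
  ε : S → ℝ≥0
  ν : Measure S
  measurable_ε : Measurable ε
  prob_ν : IsProbabilityMeasure ν
  pos_set : 0 < φ X
  pos_iff : ε ⁻¹' Set.Ioi 0 = X
  le_kernel : ∀ (s : S) (B : Set S), MeasurableSet B → (ε s : ℝ≥0∞) * ν B ≤ P s B

end Chain

namespace Minorization

variable {S : Type*} [MeasurableSpace S] {φ : Measure S} {P : Kernel S S} {X : Set S}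

instance (M : Minorization φ P X) : IsProbabilityMeasure M.ν := M.prob_ν

lemma smul_le (M : Minorization φ P X) (s : S) : (M.ε s : ℝ≥0∞) • M.ν ≤ P s :=
  Measure.le_iff.2 fun B hB => by simpa using M.le_kernel s B hB

lemma ε_le_one [IsMarkovKernel P] (M : Minorization φ P X) (s : S) : M.ε s ≤ 1 := by
  have h := M.le_kernel s Set.univ MeasurableSet.univ
  simpa using h

/-- The remainder kernel: `R_ν(x, ·) = (P(x, ·) - ε(x) ν) / (1 - ε(x))` if `ε(x) < 1`,
and `R_ν(x, ·) = ν` if `ε(x) = 1`. -/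
def remainder [IsMarkovKernel P] (M : Minorization φ P X) : Kernel S S where
  toFun x := if M.ε x < 1 then
      (1 - (M.ε x : ℝ≥0∞))⁻¹ • (P x - (M.ε x : ℝ≥0∞) • M.ν)
    else M.ν
  measurable' := by
    have hε := M.measurable_ε
    refine Measurable.ite (measurableSet_lt hε measurable_const) ?_ measurable_const
    refine Measure.measurable_of_measurable_coe _ fun B hB => ?_
    have : (fun x => ((1 - (M.ε x : ℝ≥0∞))⁻¹ • (P x - (M.ε x : ℝ≥0∞) • M.ν)) B) =
        fun x => (1 - (M.ε x : ℝ≥0∞))⁻¹ * (P x B - (M.ε x : ℝ≥0∞) * M.ν B) := by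
      funext x
      have : IsFiniteMeasure ((M.ε x : ℝ≥0∞) • M.ν) := M.ν.smul_finite ENNReal.coe_ne_top
      rw [Measure.smul_apply, Measure.sub_apply hB (M.smul_le x)]
      simp
    rw [this]
    have := P.measurable_coe hB
    fun_prop

instance [IsMarkovKernel P] (M : Minorization φ P X) : IsMarkovKernel M.remainder where
  isProbabilityMeasure x := by
    change IsProbabilityMeasure (if M.ε x < 1 then
      (1 - (M.ε x : ℝ≥0∞))⁻¹ • (P x - (M.ε x : ℝ≥0∞) • M.ν) else M.ν)
    split_ifs with h
    · constructor
      have : IsFiniteMeasure ((M.ε x : ℝ≥0∞) • M.ν) := M.ν.smul_finite ENNReal.coe_ne_top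
      rw [Measure.smul_apply, Measure.sub_apply MeasurableSet.univ (M.smul_le x)]
      simp only [measure_univ, Measure.smul_apply, smul_eq_mul, mul_one]
      refine ENNReal.inv_mul_cancel ?_ (by simp)
      have h' : (M.ε x : ℝ≥0∞) < 1 := by exact_mod_cast h
      exact (tsub_pos_of_lt h').ne'
    · exact M.prob_ν

/-- `Q_ν((x, y), ·)`: the remainder kernel at `x` if `y = 0`, and `ν` if `y = 1`
(`{0, 1}` is modelled by `Bool`, with `true` for `1`). -/
def Q [IsMarkovKernel P] (M : Minorization φ P X) : Kernel (S × Bool) S where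
  toFun z := if z.2 = true then M.ν else M.remainder z.1
  measurable' := Measurable.ite (measurable_snd (MeasurableSet.singleton true))
    measurable_const (M.remainder.measurable.comp measurable_fst)

instance [IsMarkovKernel P] (M : Minorization φ P X) : IsMarkovKernel M.Q where
  isProbabilityMeasure z := by
    change IsProbabilityMeasure (if z.2 = true then M.ν else M.remainder z.1)
    split_ifs <;> infer_instance

/-- `b_ε(x, ·) = (1 - ε(x)) δ₀ + ε(x) δ₁`. -/
def b (M : Minorization φ P X) : Kernel S Bool where
  toFun x := (1 - (M.ε x : ℝ≥0∞)) • Measure.dirac false + (M.ε x : ℝ≥0∞) • Measure.dirac true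
  measurable' := by
    have hε := M.measurable_ε
    refine Measure.measurable_of_measurable_coe _ fun B hB => ?_
    simp only [Measure.add_apply, Measure.smul_apply, smul_eq_mul]
    fun_prop

instance [IsMarkovKernel P] (M : Minorization φ P X) : IsMarkovKernel M.b where
  isProbabilityMeasure x := by
    constructor
    change ((1 - (M.ε x : ℝ≥0∞)) • Measure.dirac false +
      (M.ε x : ℝ≥0∞) • Measure.dirac true) Set.univ = 1
    have h' : (M.ε x : ℝ≥0∞) ≤ 1 := by exact_mod_cast M.ε_le_one x
    simpa using tsub_add_cancel_of_le h'

/-- The split kernel `P^split((x, y), d(x', y')) = Q_ν((x, y), dx') b_ε(x', dy')`. -/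
def splitKernel [IsMarkovKernel P] (M : Minorization φ P X) : Kernel (S × Bool) (S × Bool) :=
  M.Q.compProd (Kernel.prodMkLeft (S × Bool) M.b)

instance [IsMarkovKernel P] (M : Minorization φ P X) : IsMarkovKernel M.splitKernel := by
  unfold splitKernel; infer_instance

/-- The atom `S₀ = X × {1}` of the split chain. -/
def atom (_ : Minorization φ P X) : Set (S × Bool) := X ×ˢ {true}

/-- `𝔼_z[1_B(X_σ)]` for the split chain `Z_k = (X_k, Y_k)` started at `z`, where `σ` is the return
time to the atom; trajectories with `σ = ∞` contribute `0`. For `z` in the atom this is the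
terminating state probability of `B ⊆ X`. -/
def terminatingProb [IsMarkovKernel P] (M : Minorization φ P X) (z : S × Bool) (B : Set X) :
    ℝ≥0∞ :=
  ∫⁻ ω in {ω | returnTime M.atom ω < ⊤},
    (Subtype.val '' B).indicator 1 (ω ((returnTime M.atom ω).untopD 0)).1
    ∂(chainLaw M.splitKernel z)

open scoped Classical in
/-- `𝔼_z[∑_{k=1}^{σ} f(X_k)]` for the split chain started at `z`, where `σ` is the return time
to the atom. -/
def cycleExpectation [IsMarkovKernel P] (M : Minorization φ P X) (z : S × Bool) (f : S → ℝ≥0∞) :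
    ℝ≥0∞ :=
  ∫⁻ ω, ∑' k : ℕ, (if 1 ≤ k ∧ (k : WithTop ℕ) ≤ returnTime M.atom ω then f (ω k).1 else 0)
    ∂(chainLaw M.splitKernel z)

end Minorization

end GFN

end

/-! Write `P = K + ε ⊗ ν`, with `K` the `residual` kernel. For the split chain started in the atom,
the law of `X_{n+1}` on the event of no return at times `1, …, n` is `ν Kⁿ`
(`lintegral_avoids_atom`). Hence the occupation measure of a cycle is `λ = ∑ ν Kⁿ`, and `X_σ` has
law `ε λ`; neither depends on the starting point in the atom.

Peeling off the first term gives `λ = λ K + ν`, while `λ P = λ K + (∫ ε dλ) ν`, so invariance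
reduces to `∫ ε dλ = 1`, i.e. to almost sure return to the atom. By telescoping this means that `c =
lim ν Kⁿ(S)` vanishes. Now `c · Pⁱε(x)` bounds from below the probability that the last visit to the
atom is at time `i`, so `c ∑ Pⁱε ≤ 1` (`iInf_mul_sum_le`). Harris recurrence of a level set `B = {ε
> δ}` makes `∑ Pⁱ 1_B`, hence `∑ Pⁱε`, infinite on `B`; so `c = 0`.

For uniqueness, a normalized invariant `μ` satisfies `μ = μ K + ν`; iterating gives `λ ≤ μ`.
Irreducibility yields a strictly positive weight with integral one against both, which forces
equality (`eq_cycleMeasure`). -/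

noncomputable section

namespace GFN

/-! ### Kernels acting on nonnegative functions -/

section Average

variable {S T : Type*} [MeasurableSpace S] [MeasurableSpace T]

/-- The action of a kernel on functions, `(P f)(x) = ∫ f(y) P(x, dy)`. -/
def avg (P : Kernel S T) (f : T → ℝ≥0∞) : S → ℝ≥0∞ := fun x => ∫⁻ y, f y ∂(P x)

lemma measurable_avg (P : Kernel S T) {f : T → ℝ≥0∞} (hf : Measurable f) :
    Measurable (avg P f) := hf.lintegral_kernel

lemma avg_mono (P : Kernel S T) : Monotone (avg P) := fun _ _ h _ => lintegral_mono h

lemma measurable_avg_iterate (P : Kernel S S) {f : S → ℝ≥0∞} (hf : Measurable f) (n : ℕ) :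
    Measurable ((avg P)^[n] f) := by
  induction n with
  | zero => exact hf
  | succ n ih => rw [Function.iterate_succ_apply']; exact measurable_avg P ih

lemma avg_add (P : Kernel S T) {f g : T → ℝ≥0∞} (hf : Measurable f) :
    avg P (f + g) = avg P f + avg P g := by
  ext x; exact lintegral_add_left hf g

lemma avg_const_mul (P : Kernel S T) (c : ℝ≥0∞) {f : T → ℝ≥0∞} (hf : Measurable f) :
    avg P (fun x => c * f x) = fun x => c * avg P f x := by
  ext x; exact lintegral_const_mul c hf

lemma avg_tsum (P : Kernel S T) {f : ℕ → T → ℝ≥0∞} (hf : ∀ n, Measurable (f n)) :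
    avg P (fun x => ∑' n, f n x) = fun x => ∑' n, avg P (f n) x := by
  ext x; exact lintegral_tsum fun n => (hf n).aemeasurable

lemma avg_sum (P : Kernel S T) {f : ℕ → T → ℝ≥0∞} (hf : ∀ n, Measurable (f n)) (s : Finset ℕ) :
    avg P (fun x => ∑ n ∈ s, f n x) = fun x => ∑ n ∈ s, avg P (f n) x := by
  ext x; exact lintegral_finsetSum s fun n _ => hf n

lemma lintegral_bind_kernel (μ : Measure S) (P : Kernel S T) {f : T → ℝ≥0∞} (hf : Measurable f) :
    ∫⁻ y, f y ∂(μ.bind P) = ∫⁻ x, avg P f x ∂μ :=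
  Measure.lintegral_bind P.measurable.aemeasurable hf.aemeasurable

lemma lintegral_kernel_pow (P : Kernel S S) {f : S → ℝ≥0∞} (hf : Measurable f) (n : ℕ) (x : S) :
    ∫⁻ y, f y ∂((P ^ n) x) = (avg P)^[n] f x := by
  induction n generalizing f with
  | zero =>
    rw [pow_zero]
    change ∫⁻ y, f y ∂(Kernel.id x) = f x
    rw [Kernel.id_apply, lintegral_dirac' _ hf]
  | succ n ih =>
    rw [Function.iterate_succ_apply, ← ih (measurable_avg P hf), pow_succ']
    exact Kernel.lintegral_comp P (P ^ n) x hf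

lemma lintegral_avg_iterate_of_invariant {P : Kernel S S} {μ : Measure S} (hμ : P.Invariant μ)
    {f : S → ℝ≥0∞} (hf : Measurable f) (n : ℕ) :
    ∫⁻ x, (avg P)^[n] f x ∂μ = ∫⁻ x, f x ∂μ := by
  induction n with
  | zero => rfl
  | succ n ih =>
    rw [Function.iterate_succ_apply', ← lintegral_bind_kernel μ P (measurable_avg_iterate P hf n),
      hμ.def, ih]

end Average

/-! ### Pathwise description of the return time -/

section ReturnTime

variable {S : Type*}

/-- The trajectories that avoid `A` at the times `1, …, n`. -/
def avoids (A : Set S) (n : ℕ) : Set (ℕ → S) := {ω | ∀ j, 1 ≤ j → j ≤ n → ω j ∉ A}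

lemma avoids_zero (A : Set S) : avoids A 0 = Set.univ := by
  ext ω; simp only [avoids, Set.mem_ofPred_eq, Set.mem_univ, iff_true]; intro j h1 h2; omega

lemma avoids_succ (A : Set S) (n : ℕ) :
    avoids A (n + 1) = avoids A n ∩ {ω | ω (n + 1) ∈ Aᶜ} := by
  ext ω
  constructor
  · exact fun h => ⟨fun j h1 h2 => h j h1 (by omega), h (n + 1) (by omega) le_rfl⟩
  · rintro ⟨h, h'⟩ j h1 h2
    rcases Nat.lt_or_ge n j with hj | hj
    · obtain rfl : j = n + 1 := by omega
      exact h'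
    · exact h j h1 hj

lemma measurableSet_avoids [MeasurableSpace S] {A : Set S} (hA : MeasurableSet A) (n : ℕ) :
    MeasurableSet (avoids A n) := by
  induction n with
  | zero => simp [avoids_zero]
  | succ n ih =>
    rw [avoids_succ]
    exact ih.inter (measurable_pi_apply (n + 1) hA.compl)

/-- Only times from `1` on count as returns, hence the shift: the summand at time `n + 1` of a cycle
survives exactly on `avoids A n`. -/
lemma le_returnTime_iff (A : Set S) (n : ℕ) (ω : ℕ → S) :
    ((n + 1 : ℕ) : WithTop ℕ) ≤ returnTime A ω ↔ ω ∈ avoids A n := by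
  constructor
  · intro h j h1 h2
    refine notMem_of_lt_hittingAfter (u := fun (k : ℕ) (ω : ℕ → S) => ω k) (n := 1)
      (lt_of_lt_of_le ?_ h) h1
    exact WithTop.coe_lt_coe.2 (Nat.lt_succ_of_le h2)
  · intro h
    unfold returnTime hittingAfter
    split_ifs with hex
    · refine WithTop.coe_le_coe.2 (le_csInf hex fun b hb => ?_)
      by_contra hlt
      rw [Nat.cast_id] at hlt
      exact h b hb.1 (by omega) hb.2
    · exact le_top

lemma returnTime_eq_of_mem {A : Set S} {n : ℕ} {ω : ℕ → S} (h : ω ∈ avoids A n)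
    (hA : ω (n + 1) ∈ A) : returnTime A ω = ((n + 1 : ℕ) : WithTop ℕ) := by
  refine le_antisymm ?_ ((le_returnTime_iff A n ω).2 h)
  by_contra hlt
  have h2 : ((n + 1 + 1 : ℕ) : WithTop ℕ) ≤ returnTime A ω := by
    rcases hr : returnTime A ω with _ | r
    · exact le_top
    · rw [hr] at hlt
      have : n + 1 < r := by
        by_contra hc
        exact hlt (WithTop.coe_le_coe.2 (not_lt.1 hc))
      exact WithTop.coe_le_coe.2 this
  exact (le_returnTime_iff A (n + 1) ω).1 h2 (n + 1) (by omega) le_rfl hA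

lemma exists_avoids_of_returnTime_lt_top {A : Set S} {ω : ℕ → S} (h : returnTime A ω < ⊤) :
    ∃ n, ω ∈ avoids A n ∧ ω (n + 1) ∈ A := by
  classical
  have hex : ∃ n, ω (n + 1) ∈ A := by
    by_contra hne
    refine h.ne (hittingAfter_eq_top_iff.2 fun j hj hjA => hne ⟨j - 1, ?_⟩)
    rwa [Nat.sub_add_cancel hj]
  refine ⟨Nat.find hex, fun j h1 h2 hjA => ?_, Nat.find_spec hex⟩
  refine Nat.find_min hex (m := j - 1) (by omega) ?_
  rwa [Nat.sub_add_cancel h1]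

/-- Decomposition of a functional of the position at the return time over the return time. -/
lemma indicator_returnTime_eq_tsum (A : Set S) (H : S → ℝ≥0∞) (ω : ℕ → S) :
    {ω | returnTime A ω < ⊤}.indicator (fun ω => H (ω ((returnTime A ω).untopD 0))) ω =
      ∑' n, (avoids A n).indicator (fun ω => A.indicator H (ω (n + 1))) ω := by
  classical
  by_cases h : returnTime A ω < ⊤
  · obtain ⟨n, hn, hnA⟩ := exists_avoids_of_returnTime_lt_top h
    rw [Set.indicator_of_mem (by exact h), tsum_eq_single n, Set.indicator_of_mem hn,
      Set.indicator_of_mem hnA, returnTime_eq_of_mem hn hnA]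
    · rfl
    · intro k hk
      by_cases hk' : ω ∈ avoids A k
      · rw [Set.indicator_of_mem hk']
        refine Set.indicator_of_notMem (fun hkA => hk ?_) _
        have := (returnTime_eq_of_mem hk' hkA).symm.trans (returnTime_eq_of_mem hn hnA)
        exact Nat.succ_injective (WithTop.coe_injective this)
      · exact Set.indicator_of_notMem hk' _
  · rw [Set.indicator_of_notMem (by exact h), eq_comm, ENNReal.tsum_eq_zero]
    intro k
    by_cases hk' : ω ∈ avoids A k
    · rw [Set.indicator_of_mem hk']
      refine Set.indicator_of_notMem (fun hkA => h ?_) _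
      rw [returnTime_eq_of_mem hk' hkA]
      exact WithTop.coe_lt_top _
    · exact Set.indicator_of_notMem hk' _

end ReturnTime

/-! ### Markov property and the chain killed at a set -/

section Markov

variable {S : Type*} [MeasurableSpace S] (P : Kernel S S) [IsMarkovKernel P]

/-- The Markov property: conditionally on the first `n + 1` states, `X_{n+1}` has law
`P(X_n, ·)`. -/
lemma setLIntegral_chainLaw_succ (s : S) (n : ℕ) {C : Set ((i : Finset.Iic n) → S)}
    (hC : MeasurableSet C) {F : S → ℝ≥0∞} (hF : Measurable F) :
    ∫⁻ ω in Preorder.frestrictLe (π := fun _ : ℕ => S) n ⁻¹' C, F (ω (n + 1)) ∂(chainLaw P s) =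
      ∫⁻ ω in Preorder.frestrictLe (π := fun _ : ℕ => S) n ⁻¹' C, avg P F (ω n)
        ∂(chainLaw P s) := by
  set κ : (n : ℕ) → Kernel ((i : Finset.Iic n) → S) S := fun n =>
    P.comap (fun h : (i : Finset.Iic n) → S => h ⟨n, Finset.mem_Iic.2 le_rfl⟩)
      (measurable_pi_apply _) with hκ
  have hlaw : chainLaw P s = Kernel.traj (X := fun _ : ℕ => S) κ 0 (fun _ => s) := rfl
  have hmC : MeasurableSet (Preorder.frestrictLe (π := fun _ : ℕ => S) n ⁻¹' C) :=
    Preorder.measurable_frestrictLe n hC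
  rw [← lintegral_indicator hmC, ← lintegral_indicator hmC]
  have hG : Measurable (C.indicator fun h => avg P F (h ⟨n, Finset.mem_Iic.2 le_rfl⟩)) :=
    ((measurable_avg P hF).comp (measurable_pi_apply _)).indicator hC
  have hL : Measurable (fun h : (i : Finset.Iic (n + 1)) → S =>
      (Preorder.frestrictLe₂ (π := fun _ : ℕ => S) n.le_succ ⁻¹' C).indicator
        (fun h => F (h ⟨n + 1, Finset.mem_Iic.2 le_rfl⟩)) h) :=
    (hF.comp (measurable_pi_apply _)).indicator (Preorder.measurable_frestrictLe₂ _ hC)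
  have h1 := lintegral_map (μ := chainLaw P s) hL
    (Preorder.measurable_frestrictLe (X := fun _ : ℕ => S) (n + 1))
  have h2 := lintegral_map (μ := chainLaw P s) hG
    (Preorder.measurable_frestrictLe (X := fun _ : ℕ => S) n)
  -- Both integrands depend on finitely many coordinates, so the identity is one between marginals;
  -- the marginal up to `n + 1` is the one up to `n` extended by `κ n`.
  refine Eq.trans h1.symm (Eq.trans ?_ h2)
  have hm : Measurable (IicProdIoc (X := fun _ : ℕ => S) n (n + 1)) := measurable_IicProdIoc
  have hLm := hL.comp hm
  rw [hlaw, Kernel.traj_map_frestrictLe_apply, Kernel.traj_map_frestrictLe_apply,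
    Kernel.partialTraj_succ_of_le n.zero_le, Kernel.lintegral_map _ hm _ hL]
  refine (Kernel.lintegral_comp _ _ _ hLm).trans (lintegral_congr fun h => ?_)
  have hmk := Kernel.IsMarkovKernel.map (κ n)
    (MeasurableEquiv.piSingleton (X := fun _ : ℕ => S) n).measurable
  rw [Kernel.lintegral_id_prod hLm]
  refine (Kernel.lintegral_map _ (MeasurableEquiv.measurable _) _
    (hLm.comp (measurable_prodMk_left (x := h)))).trans ?_
  have hr : ∀ y : (i : Finset.Ioc n (n + 1)) → S,
      IicProdIoc (X := fun _ : ℕ => S) n (n + 1) (h, y) ∈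
        Preorder.frestrictLe₂ (π := fun _ : ℕ => S) n.le_succ ⁻¹' C ↔ h ∈ C := fun y => by
    rw [Set.mem_preimage]
    exact iff_of_eq (congrArg (· ∈ C)
      (congrFun (frestrictLe₂_comp_IicProdIoc (X := fun _ : ℕ => S) n.le_succ) (h, y)))
  by_cases hh : h ∈ C
  · rw [Set.indicator_of_mem hh]
    refine lintegral_congr fun y => ?_
    simp only [Function.comp_apply]
    rw [Set.indicator_of_mem ((hr _).2 hh)]
    simp [IicProdIoc, MeasurableEquiv.piSingleton]
  · rw [Set.indicator_of_notMem hh]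
    refine lintegral_eq_zero_of_ae_eq_zero (Filter.Eventually.of_forall fun y => ?_)
    simp only [Function.comp_apply, Pi.zero_apply]
    rw [Set.indicator_of_notMem (mt (hr _).1 hh)]

lemma chainLaw_map_one (s : S) {F : S → ℝ≥0∞} (hF : Measurable F) :
    ∫⁻ ω, F (ω 1) ∂(chainLaw P s) = avg P F s := by
  have h := Kernel.map_traj_succ_self (X := fun _ : ℕ => S) (κ := fun n =>
    P.comap (fun h : (i : Finset.Iic n) → S => h ⟨n, Finset.mem_Iic.2 le_rfl⟩)
      (measurable_pi_apply _)) (a := 0)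
  have h2 : (chainLaw P s).map (fun ω => ω 1) = P s := by
    have := congrArg (fun k => k (fun _ => s)) h
    simp only [Kernel.map_apply _ (measurable_pi_apply _)] at this
    exact this
  rw [avg, ← h2, lintegral_map hF (measurable_pi_apply _)]

/-- The chain killed on entering `A`: recursion from the last step. -/
lemma lintegral_avoids_succ (s : S) {A : Set S} (hA : MeasurableSet A) (n : ℕ)
    {F : S → ℝ≥0∞} (hF : Measurable F) :
    ∫⁻ ω, (avoids A (n + 1)).indicator (fun ω => F (ω (n + 1 + 1))) ω ∂(chainLaw P s) =
      ∫⁻ ω, (avoids A n).indicator (fun ω => Aᶜ.indicator (avg P F) (ω (n + 1)))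
        ω ∂(chainLaw P s) := by
  let C : Set ((i : Finset.Iic (n + 1)) → S) := {h | ∀ j : Finset.Iic (n + 1), 1 ≤ j.1 → h j ∉ A}
  have hC : MeasurableSet C := by
    have : C = ⋂ j : Finset.Iic (n + 1), {h | 1 ≤ j.1 → h j ∉ A} := by
      ext h; simp [C]
    rw [this]
    refine MeasurableSet.iInter fun j => ?_
    by_cases hj : 1 ≤ j.1
    · have : {h : (i : Finset.Iic (n + 1)) → S | 1 ≤ j.1 → h j ∉ A} = (fun h => h j) ⁻¹' Aᶜ := by
        ext h; simp [hj]
      rw [this]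
      exact measurable_pi_apply j hA.compl
    · simp [hj]
  have hpre : Preorder.frestrictLe (π := fun _ : ℕ => S) (n + 1) ⁻¹' C = avoids A (n + 1) := by
    ext ω
    exact ⟨fun h j h1 h2 => h ⟨j, Finset.mem_Iic.2 h2⟩ h1,
      fun h j h1 => h j.1 h1 (Finset.mem_Iic.1 j.2)⟩
  have h := setLIntegral_chainLaw_succ P s (n + 1) hC hF
  rw [hpre] at h
  rw [lintegral_indicator (measurableSet_avoids hA (n + 1)), h,
    ← lintegral_indicator (measurableSet_avoids hA (n + 1)), avoids_succ]
  refine lintegral_congr fun ω => ?_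
  rw [← Set.indicator_indicator]
  rfl

lemma lintegral_avoids_zero (s : S) (A : Set S) {F : S → ℝ≥0∞} (hF : Measurable F) :
    ∫⁻ ω, (avoids A 0).indicator (fun ω => F (ω (0 + 1))) ω ∂(chainLaw P s) = avg P F s := by
  rw [avoids_zero, Set.indicator_univ]
  exact chainLaw_map_one P s hF

lemma measurable_indicator_avoids {A : Set S} (hA : MeasurableSet A) (n : ℕ) {F : S → ℝ≥0∞}
    (hF : Measurable F) :
    Measurable ((avoids A n).indicator fun ω => F (ω (n + 1))) :=
  (hF.comp (measurable_pi_apply _)).indicator (measurableSet_avoids hA n)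

lemma measurableSet_returnTime_lt_top {A : Set S} (hA : MeasurableSet A) :
    MeasurableSet {ω : ℕ → S | returnTime A ω < ⊤} := by
  have : {ω : ℕ → S | returnTime A ω < ⊤} =
      ⋃ n, avoids A n ∩ {ω | ω (n + 1) ∈ A} := by
    ext ω
    simp only [Set.mem_iUnion]
    refine ⟨exists_avoids_of_returnTime_lt_top, fun ⟨n, h1, h2⟩ => ?_⟩
    change returnTime A ω < ⊤
    rw [returnTime_eq_of_mem h1 h2]
    exact WithTop.coe_lt_top _
  rw [this]
  exact MeasurableSet.iUnion fun n =>
    (measurableSet_avoids hA n).inter (measurable_pi_apply (n + 1) hA)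

/-- Expectation of a function of the position at the return time. -/
lemma setLIntegral_returnTime (s : S) {A : Set S} (hA : MeasurableSet A) {H : S → ℝ≥0∞}
    (hH : Measurable H) :
    ∫⁻ ω in {ω | returnTime A ω < ⊤}, H (ω ((returnTime A ω).untopD 0)) ∂(chainLaw P s) =
      ∑' n, ∫⁻ ω, (avoids A n).indicator (fun ω => A.indicator H (ω (n + 1))) ω
        ∂(chainLaw P s) := by
  rw [← lintegral_indicator (measurableSet_returnTime_lt_top hA),
    lintegral_congr (indicator_returnTime_eq_tsum A H),
    lintegral_tsum fun n => (measurable_indicator_avoids hA n (hH.indicator hA)).aemeasurable]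

end Markov

/-! ### Almost sure return implies infinitely many expected visits -/

section Recurrence

variable {S : Type*} [MeasurableSpace S] (P : Kernel S S)

/-- The transition operator of the chain killed on entering `B`. -/
def taboo (B : Set S) (f : S → ℝ≥0∞) : S → ℝ≥0∞ := Bᶜ.indicator (avg P f)

lemma measurable_taboo_iterate {B : Set S} (hB : MeasurableSet B) {f : S → ℝ≥0∞}
    (hf : Measurable f) (n : ℕ) : Measurable ((taboo P B)^[n] f) := by
  induction n with
  | zero => exact hf
  | succ n ih =>
    rw [Function.iterate_succ_apply']
    exact (measurable_avg P ih).indicator hB.compl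

lemma taboo_iterate_le (B : Set S) (f : S → ℝ≥0∞) (n : ℕ) :
    (taboo P B)^[n] f ≤ (avg P)^[n] f := by
  induction n with
  | zero => exact le_rfl
  | succ n ih =>
    rw [Function.iterate_succ_apply', Function.iterate_succ_apply']
    exact (Set.indicator_le_self _ _).trans (avg_mono P ih)

variable [IsMarkovKernel P]

/-- Peel off the last step repeatedly. The outermost factor is the unkilled `avg P` because time `0`
is not required to avoid `B`. -/
lemma lintegral_avoids_eq_taboo (s : S) {B : Set S} (hB : MeasurableSet B) (n : ℕ)
    {F : S → ℝ≥0∞} (hF : Measurable F) :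
    ∫⁻ ω, (avoids B n).indicator (fun ω => F (ω (n + 1))) ω ∂(chainLaw P s) =
      avg P ((taboo P B)^[n] F) s := by
  induction n generalizing F with
  | zero => exact lintegral_avoids_zero P s B hF
  | succ n ih =>
    rw [lintegral_avoids_succ P s hB n hF, Function.iterate_succ_apply]
    exact ih ((measurable_avg P hF).indicator hB.compl)

lemma chainLaw_returnTime_lt_top (s : S) {B : Set S} (hB : MeasurableSet B) :
    chainLaw P s {ω | returnTime B ω < ⊤} =
      ∑' n, avg P ((taboo P B)^[n] (B.indicator 1)) s := by
  have h := setLIntegral_returnTime P s hB (H := 1) measurable_const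
  simp only [Pi.one_apply, setLIntegral_one] at h
  rw [h]
  exact tsum_congr fun n =>
    lintegral_avoids_eq_taboo P s hB n (measurable_const.indicator hB)

/-- If the chain returns to `B` almost surely from every point of `B`, then the expected number
of visits to `B` from a point of `B` is infinite. -/
lemma tsum_avg_iterate_eq_top {B : Set S} (hB : MeasurableSet B)
    (hret : ∀ s ∈ B, chainLaw P s {ω | returnTime B ω < ⊤} = 1) {s : S} (hs : s ∈ B) :
    ∑' n, (avg P)^[n] (B.indicator 1) s = ∞ := by
  have h1 : Measurable (B.indicator (1 : S → ℝ≥0∞)) := measurable_const.indicator hB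
  -- `t n x` is the probability that the first visit to `B`, time `0` included, is at time `n`; the
  -- sum over `n` is the hitting probability.
  set t : ℕ → S → ℝ≥0∞ := fun n => (taboo P B)^[n] (B.indicator 1) with ht
  have htm : ∀ n, Measurable (t n) := measurable_taboo_iterate P hB h1
  have htB : ∀ x ∈ B, ∑' n, t n x = 1 := by
    intro x hx
    rw [tsum_eq_single 0]
    · exact Set.indicator_of_mem hx _
    · intro n hn
      obtain ⟨m, rfl⟩ := Nat.exists_eq_succ_of_ne_zero hn
      simp only [ht, Function.iterate_succ_apply']
      exact Set.indicator_of_notMem (Set.notMem_compl_iff.2 hx) _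
  -- Off `B` this is first-step analysis; on `B` it is the return hypothesis.
  have hharm : avg P (fun x => ∑' n, t n x) = fun x => ∑' n, t n x := by
    rw [avg_tsum P htm]
    ext x
    by_cases hx : x ∈ B
    · rw [htB x hx, ← hret x hx, chainLaw_returnTime_lt_top P x hB]
    · rw [tsum_eq_zero_add' (f := fun n => t n x) ENNReal.summable]
      have h0 : t 0 x = 0 := Set.indicator_of_notMem hx _
      rw [h0, zero_add]
      refine tsum_congr fun n => ?_
      simp only [ht, Function.iterate_succ_apply']
      exact (Set.indicator_of_mem (show x ∈ Bᶜ from hx) _).symm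
  -- Harmonicity moves the bound `t k ≤ Pᵏ 1_B` to every tail. On `B` all tails are then at least
  -- `1`, whereas those of a convergent series tend to `0`.
  have htail : ∀ n x, ∑' k, t k x ≤ ∑' k, (avg P)^[k + n] (B.indicator 1) x := by
    intro n
    induction n with
    | zero => exact fun x => ENNReal.tsum_le_tsum fun k => taboo_iterate_le P B _ k x
    | succ n ih =>
      intro x
      have := avg_mono P ih x
      rw [hharm, avg_tsum P fun k => measurable_avg_iterate P h1 _] at this
      simp only [← Function.iterate_succ_apply' (avg P)] at this
      exact this
  by_contra hne
  have hlim := ENNReal.tendsto_sum_nat_add (fun k => (avg P)^[k] (B.indicator 1) s) hne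
  have := ge_of_tendsto' hlim fun n => htail n s
  rw [htB s hs] at this
  simp at this

end Recurrence

/-! ### Splitting `P` into a residual and a regenerating part -/

namespace Minorization

variable {S : Type*} [MeasurableSpace S] {φ : Measure S} {P : Kernel S S} {X : Set S}

lemma measurable_coe_ε (M : Minorization φ P X) : Measurable fun x => (M.ε x : ℝ≥0∞) :=
  M.measurable_ε.coe_nnreal_ennreal

lemma measurableSet_X (M : Minorization φ P X) : MeasurableSet X := by
  rw [← M.pos_iff]; exact M.measurable_ε measurableSet_Ioi

lemma ε_pos_iff (M : Minorization φ P X) (x : S) : 0 < M.ε x ↔ x ∈ X := by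
  conv_rhs => rw [← M.pos_iff]
  rfl

lemma ε_eq_zero (M : Minorization φ P X) {x : S} (hx : x ∉ X) : M.ε x = 0 := by
  rw [← M.ε_pos_iff] at hx
  exact le_antisymm (not_lt.1 hx) zero_le

lemma measurableSet_atom (M : Minorization φ P X) : MeasurableSet M.atom :=
  M.measurableSet_X.prod (MeasurableSet.singleton true)

/-- Averaging a function on the split space over the second coordinate. -/
lemma lintegral_b (M : Minorization φ P X) (F : S × Bool → ℝ≥0∞) (x : S) :
    ∫⁻ y, F (x, y) ∂(M.b x) =
      (1 - (M.ε x : ℝ≥0∞)) * F (x, false) + M.ε x * F (x, true) := by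
  change ∫⁻ y, F (x, y) ∂((1 - (M.ε x : ℝ≥0∞)) • Measure.dirac false +
    (M.ε x : ℝ≥0∞) • Measure.dirac true) = _
  rw [lintegral_add_measure, lintegral_smul_measure, lintegral_smul_measure, lintegral_dirac,
    lintegral_dirac, smul_eq_mul, smul_eq_mul]

variable [IsMarkovKernel P] (M : Minorization φ P X)

/-- The part of `P` that is not regenerated: `K(x, ·) = (1 - ε(x)) R_ν(x, ·) = P(x, ·) - ε(x) ν`. -/
def residual : Kernel S S where
  toFun x := (1 - (M.ε x : ℝ≥0∞)) • M.remainder x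
  measurable' := by
    refine Measure.measurable_of_measurable_coe _ fun B hB => ?_
    have h := M.remainder.measurable_coe hB
    have hε := M.measurable_coe_ε
    simp only [Measure.smul_apply, smul_eq_mul]
    fun_prop

lemma residual_apply (x : S) : M.residual x = (1 - (M.ε x : ℝ≥0∞)) • M.remainder x := rfl

lemma kernel_eq_residual_add (x : S) : P x = M.residual x + (M.ε x : ℝ≥0∞) • M.ν := by
  have : IsFiniteMeasure ((M.ε x : ℝ≥0∞) • M.ν) := M.ν.smul_finite ENNReal.coe_ne_top
  rw [residual_apply]
  change P x = (1 - (M.ε x : ℝ≥0∞)) • (if M.ε x < 1 then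
      (1 - (M.ε x : ℝ≥0∞))⁻¹ • (P x - (M.ε x : ℝ≥0∞) • M.ν) else M.ν) + (M.ε x : ℝ≥0∞) • M.ν
  split_ifs with h
  · have h' : (M.ε x : ℝ≥0∞) < 1 := by exact_mod_cast h
    rw [smul_smul, ENNReal.mul_inv_cancel (tsub_pos_of_lt h').ne' (by simp), one_smul,
      Measure.sub_add_cancel_of_le (M.smul_le x)]
  · have h1 : M.ε x = 1 := le_antisymm (M.ε_le_one x) (not_lt.1 h)
    have hle := M.smul_le x
    rw [h1] at hle ⊢
    simp only [ENNReal.coe_one, tsub_self, zero_smul, one_smul, zero_add] at hle ⊢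
    -- Where `ε = 1`, the bound `ν ≤ P x` between probability measures is an equality.
    exact (Measure.eq_of_le_of_measure_univ_eq hle (by simp)).symm

lemma avg_kernel_eq (f : S → ℝ≥0∞) (x : S) :
    avg P f x = avg M.residual f x + M.ε x * ∫⁻ y, f y ∂M.ν := by
  rw [avg, M.kernel_eq_residual_add x, lintegral_add_measure, lintegral_smul_measure]
  rfl

lemma avg_residual_one_add (x : S) : avg M.residual 1 x + M.ε x = 1 := by
  have := M.avg_kernel_eq 1 x
  simpa [avg] using this.symm

lemma bind_kernel_eq (μ : Measure S) :
    μ.bind P = μ.bind M.residual + (∫⁻ x, M.ε x ∂μ) • M.ν := by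
  ext B hB
  have h1 : Measurable (B.indicator (1 : S → ℝ≥0∞)) := measurable_const.indicator hB
  rw [← lintegral_indicator_one hB, lintegral_bind_kernel μ P h1,
    lintegral_congr (M.avg_kernel_eq _), lintegral_add_left (measurable_avg _ h1),
    lintegral_mul_const _ M.measurable_coe_ε, ← lintegral_bind_kernel μ _ h1]
  simp [lintegral_indicator_one hB]

/-! ### Excursions from the atom and almost sure return -/

/-- The law `ν Kⁿ` of `X_{n+1}` for the split chain started in the atom, restricted to the event
that the atom is not visited at times `1, …, n`. -/
def excursionLaw : ℕ → Measure S
  | 0 => M.ν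
  | n + 1 => (excursionLaw n).bind M.residual

/-- The expected occupation measure of a cycle of the split chain. -/
def cycleMeasure : Measure S := Measure.sum M.excursionLaw

lemma lintegral_excursionLaw_succ (n : ℕ) {f : S → ℝ≥0∞} (hf : Measurable f) :
    ∫⁻ x, f x ∂(M.excursionLaw (n + 1)) = ∫⁻ x, avg M.residual f x ∂(M.excursionLaw n) :=
  lintegral_bind_kernel _ _ hf

lemma lintegral_excursionLaw (n : ℕ) {f : S → ℝ≥0∞} (hf : Measurable f) :
    ∫⁻ x, f x ∂(M.excursionLaw n) = ∫⁻ x, (avg M.residual)^[n] f x ∂M.ν := by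
  induction n generalizing f with
  | zero => rfl
  | succ n ih =>
    rw [lintegral_excursionLaw_succ M n hf, ih (measurable_avg _ hf), Function.iterate_succ_apply]

lemma excursionLaw_univ_eq (n : ℕ) :
    M.excursionLaw n Set.univ =
      M.excursionLaw (n + 1) Set.univ + ∫⁻ x, M.ε x ∂(M.excursionLaw n) := by
  have h := M.lintegral_excursionLaw_succ n (f := 1) measurable_const
  simp only [Pi.one_apply, lintegral_one] at h
  rw [h, ← lintegral_add_left (f := avg M.residual 1) (measurable_avg _ measurable_const),
    lintegral_congr M.avg_residual_one_add, lintegral_one]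

/-- Telescoping, as `K 1 = 1 - ε`: each step loses exactly the mass that returns to the atom. -/
lemma sum_lintegral_ε_add (n : ℕ) :
    ∑ i ∈ Finset.range n, ∫⁻ x, M.ε x ∂(M.excursionLaw i) + M.excursionLaw n Set.univ = 1 := by
  induction n with
  | zero => simp [excursionLaw]
  | succ n ih =>
    rw [Finset.sum_range_succ, add_assoc, add_comm (∫⁻ x, M.ε x ∂_), ← excursionLaw_univ_eq, ih]

lemma antitone_excursionLaw_univ : Antitone fun n => M.excursionLaw n Set.univ :=
  antitone_nat_of_succ_le fun n => by rw [excursionLaw_univ_eq M n]; exact le_self_add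

/-- Renewal inequality: `c ∑_{i<n} Pⁱ ε ≤ 1`, where `c` is the probability that the split chain
started in the atom never returns to it. -/
lemma iInf_mul_sum_le (n : ℕ) (x : S) :
    (⨅ k, M.excursionLaw k Set.univ) *
      ∑ i ∈ Finset.range n, (avg P)^[i] (fun y => (M.ε y : ℝ≥0∞)) x ≤ 1 := by
  set c := ⨅ k, M.excursionLaw k Set.univ with hc
  have hεm := M.measurable_coe_ε
  have hkm : ∀ n, Measurable ((avg M.residual)^[n] (1 : S → ℝ≥0∞)) :=
    measurable_avg_iterate _ measurable_const
  have hkν : ∀ n, c ≤ ∫⁻ y, (avg M.residual)^[n] 1 y ∂M.ν := by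
    intro n
    have h := M.lintegral_excursionLaw n (f := 1) measurable_const
    simp only [Pi.one_apply, lintegral_one] at h
    rw [← h]
    exact iInf_le _ n
  -- Keeping the survival term `Kⁿ 1` makes the induction close: `P Kⁿ 1 = Kⁿ⁺¹ 1 + ε ∫ Kⁿ 1 dν ≥
  -- Kⁿ⁺¹ 1 + c ε`, and `c ε` is the new term `i = 0`.
  have key : ∀ n x, (avg M.residual)^[n] 1 x +
      c * ∑ i ∈ Finset.range n, (avg P)^[i] (fun y => (M.ε y : ℝ≥0∞)) x ≤ 1 := by
    intro n
    induction n with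
    | zero => intro x; simp
    | succ n ih =>
      intro x
      have h1 : avg P ((avg M.residual)^[n] 1 + fun x =>
          c * ∑ i ∈ Finset.range n, (avg P)^[i] (fun y => (M.ε y : ℝ≥0∞)) x) x ≤ 1 := by
        refine (avg_mono P ih x).trans ?_
        simp [avg]
      rw [avg_add P (hkm n), avg_const_mul P c (Finset.measurable_sum _ fun i _ =>
          measurable_avg_iterate P hεm i), avg_sum P (measurable_avg_iterate P hεm)] at h1
      simp only [Pi.add_apply, ← Function.iterate_succ_apply' (avg P)] at h1
      refine le_trans ?_ h1
      rw [M.avg_kernel_eq, ← Function.iterate_succ_apply' (avg M.residual),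
        Finset.sum_range_succ', mul_add, add_assoc, add_comm (c * _ : ℝ≥0∞) (c * _ : ℝ≥0∞)]
      refine add_le_add le_rfl (add_le_add ?_ le_rfl)
      rw [mul_comm]
      exact mul_le_mul' le_rfl (hkν n)
  exact le_add_self.trans (key n x)

/-- Under Harris recurrence, the split chain started in the atom returns to it almost surely. -/
lemma iInf_excursionLaw_univ (hP : HarrisRecurrent φ P) :
    ⨅ k, M.excursionLaw k Set.univ = 0 := by
  obtain ⟨δ, hδ, hφ⟩ : ∃ δ : ℝ≥0, 0 < δ ∧ 0 < φ {x | δ < M.ε x} := by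
    by_contra! hne
    have hX : X = ⋃ n : ℕ, {x | (1 / ((n : ℝ≥0) + 1)) < M.ε x} := by
      ext x
      rw [← M.ε_pos_iff, Set.mem_iUnion]
      refine ⟨fun h => exists_nat_one_div_lt h, fun ⟨n, hn⟩ => lt_of_le_of_lt zero_le hn⟩
    have := M.pos_set
    rw [hX, measure_iUnion_null fun n => le_antisymm (hne _ (by positivity)) zero_le] at this
    exact this.false
  set B := {x | δ < M.ε x} with hB
  have hBm : MeasurableSet B := measurableSet_lt measurable_const M.measurable_ε
  obtain ⟨s, hs⟩ := nonempty_of_measure_ne_zero hφ.ne'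
  have htop := tsum_avg_iterate_eq_top P hBm (hP.returns B hBm hφ) hs
  have h1 : Measurable (B.indicator (1 : S → ℝ≥0∞)) := measurable_const.indicator hBm
  have hle : ∀ n x, (δ : ℝ≥0∞) * (avg P)^[n] (B.indicator 1) x ≤
      (avg P)^[n] (fun y => (M.ε y : ℝ≥0∞)) x := by
    intro n
    induction n with
    | zero =>
      intro x
      by_cases hx : x ∈ B
      · simpa [hx] using (show δ < M.ε x from hx).le
      · simp [hx]
    | succ n ih =>
      intro x
      have := avg_mono P ih x
      rw [avg_const_mul P _ (measurable_avg_iterate P h1 n)] at this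
      rw [Function.iterate_succ_apply', Function.iterate_succ_apply']
      exact this
  have htop' : ∑' n, (avg P)^[n] (fun y => (M.ε y : ℝ≥0∞)) s = ∞ := by
    refine top_le_iff.1 (le_trans ?_ (ENNReal.tsum_le_tsum fun n => hle n s))
    rw [ENNReal.tsum_mul_left, htop, ENNReal.mul_top (by exact_mod_cast hδ.ne')]
  by_contra hc
  have hbd : (⨅ k, M.excursionLaw k Set.univ) *
      ∑' n, (avg P)^[n] (fun y => (M.ε y : ℝ≥0∞)) s ≤ 1 := by
    rw [← ENNReal.tsum_mul_left]
    refine ENNReal.tsum_le_of_sum_range_le fun n => ?_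
    rw [← Finset.mul_sum]
    exact M.iInf_mul_sum_le n s
  rw [htop', ENNReal.mul_top hc] at hbd
  simp at hbd

/-! ### Invariance and uniqueness of the cycle measure -/

lemma lintegral_cycleMeasure (f : S → ℝ≥0∞) :
    ∫⁻ x, f x ∂M.cycleMeasure = ∑' n, ∫⁻ x, f x ∂(M.excursionLaw n) :=
  lintegral_sum_measure f M.excursionLaw

lemma lintegral_ε_cycleMeasure (hP : HarrisRecurrent φ P) :
    ∫⁻ x, M.ε x ∂M.cycleMeasure = 1 := by
  rw [lintegral_cycleMeasure]
  have h1 := ENNReal.tendsto_nat_tsum fun n => ∫⁻ x, M.ε x ∂(M.excursionLaw n)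
  have h2 := tendsto_atTop_iInf M.antitone_excursionLaw_univ
  rw [M.iInf_excursionLaw_univ hP] at h2
  have h3 := h1.add h2
  simp only [sum_lintegral_ε_add, add_zero] at h3
  exact (tendsto_nhds_unique h3 tendsto_const_nhds)

lemma cycleMeasure_eq : M.cycleMeasure.bind M.residual + M.ν = M.cycleMeasure := by
  ext B hB
  have h1 : Measurable (B.indicator (1 : S → ℝ≥0∞)) := measurable_const.indicator hB
  rw [Measure.add_apply, ← lintegral_indicator_one hB, lintegral_bind_kernel _ _ h1,
    lintegral_cycleMeasure, ← lintegral_indicator_one hB,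
    ← lintegral_indicator_one (μ := M.cycleMeasure) hB, lintegral_cycleMeasure,
    tsum_eq_zero_add' (f := fun n => ∫⁻ x, B.indicator 1 x ∂(M.excursionLaw n)) ENNReal.summable,
    add_comm]
  congr 1
  exact tsum_congr fun n => (M.lintegral_excursionLaw_succ n h1).symm

lemma invariant_cycleMeasure (hP : HarrisRecurrent φ P) : P.Invariant M.cycleMeasure := by
  rw [Kernel.Invariant, M.bind_kernel_eq, M.lintegral_ε_cycleMeasure hP, one_smul, cycleMeasure_eq]

lemma cycleMeasure_le {μ : Measure S} (hμ : P.Invariant μ) (hε : ∫⁻ x, M.ε x ∂μ = 1) :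
    M.cycleMeasure ≤ μ := by
  have hstep : μ.bind M.residual + M.ν = μ := by
    have := M.bind_kernel_eq μ
    rwa [hε, one_smul, hμ.def, eq_comm] at this
  -- All `f` at once, since the inductive step replaces `f` by `K f`.
  have hf : ∀ n, ∀ f : S → ℝ≥0∞, Measurable f →
      ∑ i ∈ Finset.range n, ∫⁻ x, f x ∂(M.excursionLaw i) ≤ ∫⁻ x, f x ∂μ := by
    intro n
    induction n with
    | zero => simp
    | succ n ih =>
      intro f hf
      rw [Finset.sum_range_succ', ← hstep, lintegral_add_measure, lintegral_bind_kernel _ _ hf]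
      refine add_le_add ?_ le_rfl
      simp only [M.lintegral_excursionLaw_succ _ hf]
      exact ih _ (measurable_avg _ hf)
  refine Measure.le_iff.2 fun B hB => ?_
  rw [← lintegral_indicator_one hB, ← lintegral_indicator_one hB, lintegral_cycleMeasure]
  exact ENNReal.tsum_le_of_sum_range_le fun n => hf n _ (measurable_const.indicator hB)

lemma eq_cycleMeasure (hP : HarrisRecurrent φ P) {μ : Measure S} (hμ : P.Invariant μ)
    (hε : ∫⁻ x, M.ε x ∂μ = 1) : μ = M.cycleMeasure := by
  have hεm := M.measurable_coe_ε
  have him := measurable_avg_iterate P hεm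
  -- Both measures may be infinite, so `λ ≤ μ` cannot be closed by comparing masses. The weight `w`
  -- makes both masses `1`; it is positive everywhere and finite almost everywhere, so the density
  -- can be inverted afterwards.
  set w : S → ℝ≥0∞ := fun x =>
    ∑' n : ℕ, (2⁻¹ : ℝ≥0∞) ^ (n + 1) * (avg P)^[n] (fun y => (M.ε y : ℝ≥0∞)) x with hw
  have hwm : Measurable w := Measurable.tsum fun n => (him n).const_mul _
  have hw0 : ∀ x, w x ≠ 0 := by
    intro x h0
    obtain ⟨n, hn⟩ := hP.irreducible.irreducible M.measurableSet_X M.pos_set x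
    have h0n := ENNReal.tsum_eq_zero.1 h0 n
    rw [mul_eq_zero, or_iff_right (pow_ne_zero _ (by simp)), ← lintegral_kernel_pow P hεm,
      lintegral_eq_zero_iff hεm] at h0n
    refine hn.ne' (measure_mono_null (fun y hy => ?_) h0n)
    have := (M.ε_pos_iff y).2 hy
    simpa using this.ne'
  have hwint : ∀ ρ : Measure S, P.Invariant ρ → ∫⁻ x, M.ε x ∂ρ = 1 → ∫⁻ x, w x ∂ρ = 1 := by
    intro ρ hρ hρε
    rw [hw, lintegral_tsum fun n => ((him n).const_mul _).aemeasurable]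
    simp only [lintegral_const_mul _ (him _), lintegral_avg_iterate_of_invariant hρ hεm, hρε,
      mul_one]
    rw [ENNReal.tsum_geometric_add_one, ENNReal.one_sub_inv_two, inv_inv,
      ENNReal.inv_mul_cancel (by simp) (by simp)]
  have hμw := hwint μ hμ hε
  have hlw := hwint _ (M.invariant_cycleMeasure hP) (M.lintegral_ε_cycleMeasure hP)
  have hle := M.cycleMeasure_le hμ hε
  have hwle : M.cycleMeasure.withDensity w ≤ μ.withDensity w := Measure.le_iff.2 fun B hB => by
    rw [withDensity_apply _ hB, withDensity_apply _ hB]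
    exact lintegral_mono' (Measure.restrict_mono le_rfl hle) le_rfl
  have hfin : IsFiniteMeasure (M.cycleMeasure.withDensity w) :=
    isFiniteMeasure_withDensity (by simp [hlw])
  have hfin' : IsFiniteMeasure (μ.withDensity w) := isFiniteMeasure_withDensity (by simp [hμw])
  have hweq : M.cycleMeasure.withDensity w = μ.withDensity w :=
    Measure.eq_of_le_of_measure_univ_eq hwle (by simp [hμw, hlw])
  have hnt : ∀ ρ : Measure S, ∫⁻ x, w x ∂ρ = 1 → ∀ᵐ x ∂ρ, w x ≠ ∞ := fun ρ hρ =>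
    (ae_lt_top hwm (by simp [hρ])).mono fun x hx => hx.ne
  rw [← withDensity_inv_same hwm (.of_forall hw0) (hnt μ hμw), ← hweq,
    withDensity_inv_same hwm (.of_forall hw0) (hnt _ hlw)]

/-! ### Cycles of the split chain -/

lemma avg_splitKernel {F : S × Bool → ℝ≥0∞} (hF : Measurable F) (z : S × Bool) :
    avg M.splitKernel F z = ∫⁻ x, ∫⁻ y, F (x, y) ∂(M.b x) ∂(M.Q z) := by
  rw [avg, splitKernel, Kernel.lintegral_compProd _ _ _ hF]
  rfl

/-- Killing at the atom leaves only the branch `y = 0`, of weight `1 - ε`, followed by `R_ν`: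
together these are `K`. The start `z` enters only through `Q_ν(z, ·) = ν`. -/
lemma lintegral_avoids_atom {z : S × Bool} (hz : z ∈ M.atom) (n : ℕ) {F : S × Bool → ℝ≥0∞}
    (hF : Measurable F) :
    ∫⁻ ω, (avoids M.atom n).indicator (fun ω => F (ω (n + 1))) ω ∂(chainLaw M.splitKernel z) =
      ∫⁻ x, ∫⁻ y, F (x, y) ∂(M.b x) ∂(M.excursionLaw n) := by
  induction n generalizing F with
  | zero =>
    rw [lintegral_avoids_zero _ _ _ hF, avg_splitKernel M hF]
    have : M.Q z = M.ν := if_pos hz.2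
    rw [this]
    rfl
  | succ n ih =>
    have hbF : Measurable fun x => ∫⁻ y, F (x, y) ∂(M.b x) := hF.lintegral_kernel_prod_right'
    rw [lintegral_avoids_succ _ _ M.measurableSet_atom n hF,
      ih ((measurable_avg _ hF).indicator M.measurableSet_atom.compl),
      lintegral_excursionLaw_succ M n hbF]
    refine lintegral_congr fun x => ?_
    rw [lintegral_b]
    have h0 : (x, false) ∈ M.atomᶜ := fun h => by simpa using h.2
    -- Off `X` the point `(x, true)` is not killed, but it has weight `ε x = 0`.
    have h1 : (M.ε x : ℝ≥0∞) * M.atomᶜ.indicator (avg M.splitKernel F) (x, true) = 0 := by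
      by_cases hx : x ∈ X
      · have hxa : (x, true) ∈ M.atom := ⟨hx, rfl⟩
        rw [Set.indicator_of_notMem (Set.notMem_compl_iff.2 hxa), mul_zero]
      · rw [M.ε_eq_zero hx, ENNReal.coe_zero, zero_mul]
    rw [h1, add_zero, Set.indicator_of_mem h0, avg_splitKernel M hF, avg, residual_apply,
      lintegral_smul_measure]
    rfl

lemma cycleExpectation_eq {z : S × Bool} (hz : z ∈ M.atom) {f : S → ℝ≥0∞} (hf : Measurable f) :
    M.cycleExpectation z f = ∫⁻ s, f s ∂M.cycleMeasure := by
  classical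
  have hsum : ∀ ω : ℕ → S × Bool,
      (∑' k : ℕ, if 1 ≤ k ∧ (k : WithTop ℕ) ≤ returnTime M.atom ω then f (ω k).1 else 0) =
        ∑' n, (avoids M.atom n).indicator (fun ω => f (ω (n + 1)).1) ω := by
    intro ω
    rw [tsum_eq_zero_add' ENNReal.summable]
    simp only [le_returnTime_iff, Set.indicator_apply]
    simp
  have hf' : Measurable fun z : S × Bool => f z.1 := hf.comp measurable_fst
  rw [cycleExpectation, lintegral_cycleMeasure]
  refine (lintegral_congr fun ω => ?_).trans ((lintegral_tsum fun n =>
    (measurable_indicator_avoids M.measurableSet_atom n hf').aemeasurable).trans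
      (tsum_congr fun n => ?_))
  · rw [← hsum ω]
  · rw [M.lintegral_avoids_atom hz n hf']
    simp only [lintegral_const, measure_univ, mul_one]

/-- At the return time only the branch `y = 1` contributes, which puts the factor `ε` on each `ν
Kⁿ`. -/
lemma terminatingProb_eq {z : S × Bool} (hz : z ∈ M.atom) {B : Set X} (hB : MeasurableSet B) :
    M.terminatingProb z B = ∫⁻ x in Subtype.val '' B, M.ε x ∂M.cycleMeasure := by
  have hBm : MeasurableSet (Subtype.val '' B) := M.measurableSet_X.subtype_image hB
  have hH : Measurable fun z : S × Bool => (Subtype.val '' B).indicator (1 : S → ℝ≥0∞) z.1 :=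
    (measurable_const.indicator hBm).comp measurable_fst
  rw [terminatingProb, setLIntegral_returnTime M.splitKernel z M.measurableSet_atom hH,
    ← lintegral_indicator hBm, lintegral_cycleMeasure]
  refine tsum_congr fun n => ?_
  rw [M.lintegral_avoids_atom hz n (hH.indicator M.measurableSet_atom)]
  refine lintegral_congr fun x => ?_
  rw [lintegral_b]
  have h0 : (x, false) ∉ M.atom := fun h => by simpa using h.2
  rw [Set.indicator_of_notMem h0, mul_zero, zero_add]
  by_cases hx : x ∈ Subtype.val '' B
  · have hxX : x ∈ X := by obtain ⟨y, -, rfl⟩ := hx; exact y.2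
    have h1 : (x, true) ∈ M.atom := ⟨hxX, rfl⟩
    simp only [Set.indicator_of_mem h1, Set.indicator_of_mem hx, Pi.one_apply, mul_one]
  · rw [Set.indicator_of_notMem hx]
    by_cases h1 : (x, true) ∈ M.atom
    · rw [Set.indicator_of_mem h1, Set.indicator_of_notMem hx, mul_zero]
    · rw [Set.indicator_of_notMem h1, mul_zero]

end Minorization

end GFN

end

theorem mainTheorem6 {S : Type*} [MeasurableSpace S] (φ : Measure S)
    (P : Kernel S S) [IsMarkovKernel P] (hP : GFN.HarrisRecurrent φ P)
    (X : Set S) (M : GFN.Minorization φ P X) :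
    ∃ (lam : Measure S) (Q : Measure X),
      -- `lam` is the unique invariant measure of `P` with `∫ ε dlam = 1`
      (P.Invariant lam ∧ ∫⁻ s, M.ε s ∂lam = 1 ∧
        ∀ μ : Measure S, P.Invariant μ → ∫⁻ s, M.ε s ∂μ = 1 → μ = lam) ∧
      -- it is the expected occupation measure of a cycle of the split chain
      (∀ z ∈ M.atom, ∀ f : S → ℝ≥0∞, Measurable f →
        ∫⁻ s, f s ∂lam = M.cycleExpectation z f) ∧
      -- the terminating state distribution is a well-defined probability measure `Q` on `X`
      IsProbabilityMeasure Q ∧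
      (∀ z ∈ M.atom, ∀ B : Set X, MeasurableSet B → M.terminatingProb z B = Q B) ∧
      -- with density `ε` with respect to `lam`
      ∀ B : Set X, MeasurableSet B → Q B = ∫⁻ x in Subtype.val '' B, M.ε x ∂lam := by
  have hX := M.measurableSet_X
  have hQ : ∀ B : Set X, MeasurableSet B →
      (M.cycleMeasure.withDensity fun x => (M.ε x : ℝ≥0∞)).comap Subtype.val B =
        ∫⁻ x in Subtype.val '' B, M.ε x ∂M.cycleMeasure := fun B hB => by
    rw [(MeasurableEmbedding.subtype_coe hX).comap_apply,
      withDensity_apply _ (hX.subtype_image hB)]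
  refine ⟨M.cycleMeasure, (M.cycleMeasure.withDensity fun x => (M.ε x : ℝ≥0∞)).comap Subtype.val,
    ⟨M.invariant_cycleMeasure hP, M.lintegral_ε_cycleMeasure hP,
      fun μ hμ hε => M.eq_cycleMeasure hP hμ hε⟩,
    fun z hz f hf => (M.cycleExpectation_eq hz hf).symm, ⟨?_⟩,
    fun z hz B hB => (M.terminatingProb_eq hz hB).trans (hQ B hB).symm, hQ⟩
  -- Since `ε` vanishes off `X`, restricting `ε λ` to `X` loses no mass.
  rw [hQ _ MeasurableSet.univ, Set.image_univ, Subtype.range_coe, ← M.lintegral_ε_cycleMeasure hP,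
    ← lintegral_indicator hX]
  refine lintegral_congr fun x => ?_
  by_cases hx : x ∈ X
  · rw [Set.indicator_of_mem hx]
  · rw [Set.indicator_of_notMem hx, M.ε_eq_zero hx, ENNReal.coe_zero]
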